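/- Let $M$ be a monoid. Suppose that 1. the group of units of $M$ is sofic; 2. for every non-unit $x\in M$, the (right) Schützenberger group of the $\mathcal H$-class of $x$ is an amenable group; and 3. every $\mathcal D$-class of $M$ contains only finitely many $\mathcal L$-classes. Then $M$ is sofic. Here the following terminology is used. A monoid $M$ is (left) *sofic* if for every finite subset $K\subseteq M$ and every $\epsilon>0$ there are a nonempty finite set $X$ and a map $M\times X\to X$, $(m,x)\mapsto m\cdot x$, such that $1\cdot x=x$ for all $x\in X$; for all $g,h\in K$ the proportion of $x\in X$ with $g\cdot(h\cdot x)=(gh)\cdot x$ is at least $1-\epsilon$; and for all $g,h\in K$ with $g\ne h$ the proportion of $x\in X$ with $g\cdot x=h\cdot x$ is at most $\epsilon$. (For a group this is equivalent to being a sofic group.) Green's relations are defined by $x\,\mathcal L\,y\iff Mx=My$; $x\,\mathcal R\,y\iff xM=yM$; $\mathcal H=\mathcal L\cap\mathcal R$; and $x\,\mathcal D\,y$ if and only if there is $z\in M$ with $x\,\mathcal L\,z$ and $z\,\mathcal R\,y$. The (right) Schützenberger group of an $\mathcal H$-class $H$ is the group of all permutations $\sigma$ of $H$ (acting on the right) for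 which there is $m\in M$ with $h\sigma=hm$ for all $h\in H$. A group $G$ is *amenable* if it admits a finitely additive probability measure, defined on all subsets of $G$, that is invariant under left translation. -/

import Mathlib

/-! ## Sofic monoids -/

/-- The proportion of the elements of a finite type `X` which satisfy `p`
(only used for nonempty `X`). -/
noncomputable def proportion {X : Type*} [Fintype X] (p : X → Prop) : ℝ :=
  (Nat.card {x : X // p x} : ℝ) / (Fintype.card X : ℝ)

/-- A (left) `(K, ε)`-action of the monoid `M` on the finite set `X`: a map
`M × X → X`, written here in curried form, such that `1` acts as the identity, the map is
multiplicative on `K` up to a proportion `ε` of the points, and distinct elements of `K` act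
equally on at most a proportion `ε` of the points. -/
structure IsApproxAction {M : Type*} [Monoid M] (K : Finset M) (ε : ℝ)
    {X : Type*} [Fintype X] (act : M → X → X) : Prop where
  one_act : ∀ x : X, act 1 x = x
  mul_act : ∀ g ∈ K, ∀ h ∈ K,
    1 - ε ≤ proportion (fun x : X => act g (act h x) = act (g * h) x)
  act_ne : ∀ g ∈ K, ∀ h ∈ K, g ≠ h →
    proportion (fun x : X => act g x = act h x) ≤ ε

/-- A monoid is (left) sofic if it has a `(K, ε)`-action on a nonempty finite set for every
finite subset `K` and every `ε > 0`. -/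
def IsSofic (M : Type*) [Monoid M] : Prop :=
  ∀ (K : Finset M) (ε : ℝ), 0 < ε →
    ∃ (X : Type) (_ : Fintype X) (_ : Nonempty X) (act : M → X → X),
      IsApproxAction K ε act

/-! ## Amenable groups -/

/-- A group is amenable if it admits a finitely additive probability measure, defined on all
subsets, which is invariant under left translation. -/
def IsAmenableGroup (G : Type*) [Group G] : Prop :=
  ∃ μ : Set G → ℝ,
    (∀ A, 0 ≤ μ A) ∧ μ Set.univ = 1 ∧
    (∀ A B, Disjoint A B → μ (A ∪ B) = μ A + μ B) ∧
    (∀ (g : G) (A : Set G), μ ((fun x => g * x) '' A) = μ A)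

/-! ## Green's relations -/

section Green

variable {M : Type*} [Monoid M]

/-- Green's relation `L`: `Mx = My`. -/
def GreenL (x y : M) : Prop :=
  Set.range (fun a : M => a * x) = Set.range (fun a : M => a * y)

/-- Green's relation `R`: `xM = yM`. -/
def GreenR (x y : M) : Prop :=
  Set.range (fun a : M => x * a) = Set.range (fun a : M => y * a)

/-- Green's relation `H`, the intersection of `L` and `R`. -/
def GreenH (x y : M) : Prop := GreenL x y ∧ GreenR x y

/-- Green's relation `D`, the composite of `L` and `R`. -/
def GreenD (x y : M) : Prop := ∃ z : M, GreenL x z ∧ GreenR z y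

/-- The `L`-class of `x`. -/
def lClass (x : M) : Set M := {y | GreenL x y}

/-- The `H`-class of `x`. -/
def hClass (x : M) : Set M := {y | GreenH x y}

/-- The set of all `L`-classes in the `D`-class of `x`. -/
def lClassesInDClass (x : M) : Set (Set M) := {L | ∃ y : M, GreenD x y ∧ L = lClass y}

/-- If right translation by `m` maps `x` into its own `H`-class, then it can be undone on the whole
`H`-class by right translation by a single element. -/
theorem hClass_exists_right_inverse (x m : M) (hm : x * m ∈ hClass x) :
    ∃ n : M, ∀ h ∈ hClass x, h * m * n = h := by
  have hx : x ∈ Set.range (fun a : M => x * m * a) := by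
    rw [← show Set.range (fun a : M => x * a) = Set.range (fun a : M => x * m * a) from hm.2]
    exact ⟨1, mul_one x⟩
  obtain ⟨n, hn⟩ := hx
  refine ⟨n, fun h hh => ?_⟩
  have hl : h ∈ Set.range (fun a : M => a * x) := by
    rw [show Set.range (fun a : M => a * x) = Set.range (fun a : M => a * h) from hh.1]
    exact ⟨1, one_mul h⟩
  obtain ⟨a, rfl⟩ := hl
  simp only [mul_assoc] at hn ⊢
  rw [hn]

/-- The (right) Schützenberger group of the `H`-class `H` of `x`: the group of all permutations
of `H` that are realised by right translation by some element of `M`. Permutations act from the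
right and are composed from left to right, hence the opposite of `Equiv.Perm H`. -/
def schutzenbergerGroup (x : M) : Subgroup (Equiv.Perm (hClass x))ᵐᵒᵖ where
  carrier := {σ | ∃ m : M, ∀ h : hClass x, ((σ.unop h : hClass x) : M) = (h : M) * m}
  one_mem' := ⟨1, fun h => by simp⟩
  mul_mem' := by
    rintro σ τ ⟨m, hm⟩ ⟨n, hn⟩
    refine ⟨m * n, fun h => ?_⟩
    rw [MulOpposite.unop_mul, Equiv.Perm.mul_apply, hn, hm, mul_assoc]
  inv_mem' := by
    rintro σ ⟨m, hm⟩
    have hx : x ∈ hClass x := ⟨rfl, rfl⟩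
    obtain ⟨n, hn⟩ := hClass_exists_right_inverse x m (by
      rw [← hm ⟨x, hx⟩]
      exact (σ.unop ⟨x, hx⟩).2)
    refine ⟨n, fun h => ?_⟩
    rw [MulOpposite.unop_inv]
    obtain ⟨k, rfl⟩ := σ.unop.surjective h
    rw [show (σ.unop)⁻¹ (σ.unop k) = k from σ.unop.symm_apply_apply k, hm, hn _ k.2]

end Green

open scoped Pointwise

/-! Take `X` to be `n` copies of `A × F` together with a small finite set `Y ⊆ M`. Here `A` carries
an approximate action of the units. The set `F` is a Følner set in the group `Q` of permutations
induced by right multiplication by units on a union `T` of `R`-classes containing the relevant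
non-units. A unit acts on `A` and by left translation on `F`; a non-unit `m` sends `(i, a, f)` to
`m` translated by `f`, a point of `Y`. Associativity in `M` makes this multiplicative off a small
set: right translation by a unit commutes with left multiplication, and Dedekind-finiteness says
that `gh` is a unit only if `g` and `h` are. Distinct non-units are separated because each `f` is
injective on `T`, and `n` is taken so large that `Y` is negligible
(`isSofic_of_isFolnerGroup_unitTranslation`).

Thus `Q` must be Følner (`isFolnerGroup_unitTranslation_range`). As `T` meets finitely many
`L`-classes, the subgroup of `Q` preserving each of them has finite index, and it embeds into a
finite product of Schützenberger groups. The Følner condition follows from amenability and passes to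
subgroups, finite products and finite-index overgroups. -/

/-- The Følner condition: every finite subset `S` of the group admits finite nonempty sets `F`
for which `S * F` is only a little larger than `F`. -/
def IsFolnerGroup (G : Type*) [Group G] : Prop :=
  ∀ (S : Set G) (ε : ℝ), S.Finite → 0 < ε →
    ∃ F : Set G, F.Finite ∧ F.Nonempty ∧ ((S * F).ncard : ℝ) ≤ (1 + ε) * F.ncard

/-! ### Amenability, the Følner condition and its permanence properties -/

section Folner

/-- A finitely additive set function is additive on finite disjoint families. -/
theorem finitelyAdditive_biUnion {G ι : Type*} (μ : Set G → ℝ)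
    (hadd : ∀ A B, Disjoint A B → μ (A ∪ B) = μ A + μ B)
    (I : Finset ι) (B : ι → Set G) (hB : (I : Set ι).PairwiseDisjoint B) :
    μ (⋃ i ∈ I, B i) = ∑ i ∈ I, μ (B i) := by
  classical
  induction I using Finset.induction_on with
  | empty =>
    have := hadd ∅ ∅ (by simp)
    simp only [Set.union_self] at this
    simp; linarith
  | insert a I ha ih =>
    rw [Finset.set_biUnion_insert, hadd, Finset.sum_insert ha, ih]
    · exact hB.subset (by simp)
    · rw [Set.disjoint_iUnion₂_right]
      intro i hi
      exact hB (by simp) (by simp [hi]) (fun h => ha (h ▸ hi))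

/-- In an amenable group no finite set `S` doubles all finite sets: otherwise Hall's theorem would
yield a paradoxical decomposition. -/
theorem IsAmenableGroup.exists_card_mul_lt {G : Type*} [Group G] [DecidableEq G]
    (hG : IsAmenableGroup G) (S : Finset G) : ∃ F : Finset G, (S * F).card < 2 * F.card := by
  obtain ⟨μ, hpos, huniv, hadd, hinv⟩ := hG
  by_contra! hcon
  -- Hall's condition for two copies of `G`, the point `(x, i)` being joined to the elements of `S *
  -- x`.
  have hall : ∀ s : Finset (G × Bool),
      s.card ≤ (s.biUnion fun x => S.image (fun g => g * x.1)).card := by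
    intro s
    have h1 : s.card ≤ 2 * (s.image Prod.fst).card := by
      have : s ⊆ (s.image Prod.fst) ×ˢ (Finset.univ : Finset Bool) := by
        intro x hx
        simp only [Finset.mem_product, Finset.mem_univ, and_true]
        exact Finset.mem_image_of_mem _ hx
      have := Finset.card_le_card this
      rw [Finset.card_product] at this
      simp at this
      omega
    refine h1.trans ((hcon _).trans (Finset.card_le_card ?_))
    intro y hy
    obtain ⟨a, ha, b, hb, rfl⟩ := Finset.mem_mul.1 hy
    obtain ⟨x, hx, rfl⟩ := Finset.mem_image.1 hb
    exact Finset.mem_biUnion.2 ⟨x, hx, Finset.mem_image_of_mem _ ha⟩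
  obtain ⟨f, hf, hfS⟩ := (Finset.all_card_le_biUnion_card_iff_exists_injective _).1 hall
  -- For each `i` the sets `A (i, s)` partition `G`, while their translates by `s` are pairwise
  -- disjoint over both values of `i`; invariance then gives `2 ≤ 1`.
  let A : Bool × G → Set G := fun p => {x | f (x, p.1) = p.2 * x}
  have hone : ∀ i : Bool, ∑ s ∈ S, μ (A (i, s)) = 1 := by
    intro i
    rw [← finitelyAdditive_biUnion μ hadd S (fun s => A (i, s)), ← huniv]
    · congr 1
      ext x
      obtain ⟨s, hs, hx⟩ := Finset.mem_image.1 (hfS (x, i))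
      simp only [Set.mem_iUnion, Set.mem_univ, iff_true]
      exact ⟨s, hs, hx.symm⟩
    · intro s _ t _ hst
      rw [Function.onFun, Set.disjoint_left]
      intro x hx hx'
      exact hst (mul_right_cancel ((show f (x, i) = s * x from hx).symm.trans hx'))
  have htot : ∑ p ∈ (Finset.univ : Finset Bool) ×ˢ S, μ ((fun x => p.2 * x) '' A p) ≤ 1 := by
    rw [← finitelyAdditive_biUnion μ hadd _ (fun p : Bool × G => (fun x => p.2 * x) '' A p)]
    · have := hadd (⋃ p ∈ (Finset.univ : Finset Bool) ×ˢ S, (fun x => p.2 * x) '' A p) _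
        disjoint_compl_right
      rw [Set.union_compl_self, huniv] at this
      linarith [hpos (⋃ p ∈ (Finset.univ : Finset Bool) ×ˢ S, (fun x => p.2 * x) '' A p)ᶜ]
    · intro p _ q _ hpq
      rw [Function.onFun, Set.disjoint_left]
      rintro _ ⟨x, hx, rfl⟩ ⟨y, hy, hxy⟩
      have hxy' : q.2 * y = p.2 * x := hxy
      have hx' : f (x, p.1) = p.2 * x := hx
      have hy' : f (y, q.1) = q.2 * y := hy
      have h := hf (hx'.trans (hxy'.symm.trans hy'.symm))
      obtain ⟨rfl, h1⟩ := Prod.mk.inj h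
      exact hpq (Prod.ext h1 (mul_right_cancel hxy').symm)
  rw [Finset.sum_product] at htot
  simp only [hinv, hone] at htot
  norm_num at htot

/-- If `S` enlarged every finite nonempty set by a factor `1 + ε`, iteration would make some power
`S ^ n` double every finite set. -/
theorem IsAmenableGroup.isFolnerGroup {G : Type*} [Group G] (hG : IsAmenableGroup G) :
    IsFolnerGroup G := by
  classical
  intro S ε hS hε
  lift S to Finset G using hS
  by_contra! hcon
  have hgrow : ∀ (n : ℕ) (F : Finset G), (1 + ε) ^ n * (F.card : ℝ) ≤ ((S ^ n * F).card : ℝ) := by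
    intro n
    induction n with
    | zero => intro F; simp
    | succ n ih =>
      intro F
      rcases F.eq_empty_or_nonempty with rfl | hF
      · simp
      · have h := hcon F F.finite_toSet (by simpa using hF)
        rw [← Finset.coe_mul, Set.ncard_coe_finset, Set.ncard_coe_finset] at h
        calc (1 + ε) ^ (n + 1) * (F.card : ℝ) = (1 + ε) ^ n * ((1 + ε) * F.card) := by ring
          _ ≤ (1 + ε) ^ n * ((S * F).card : ℝ) := by gcongr
          _ ≤ _ := ih _
          _ = _ := by rw [pow_succ, mul_assoc]
  obtain ⟨n, hn⟩ := pow_unbounded_of_one_lt (2 : ℝ) (show 1 < 1 + ε by linarith)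
  obtain ⟨F, hF⟩ := hG.exists_card_mul_lt (S ^ n)
  have h := hgrow n F
  have hF' : ((S ^ n * F).card : ℝ) < 2 * F.card := by exact_mod_cast hF
  nlinarith [Nat.cast_nonneg (α := ℝ) F.card]

/-- Left multiplication by `β '' S` preserves the right cosets of `β.range`. Cutting a Følner set of
`G` along these cosets, some nonempty piece satisfies the same inequality by averaging; it is pulled
back to `H` along `h ↦ β h * y`. -/
theorem IsFolnerGroup.of_injective {H G : Type*} [Group H] [Group G] (hG : IsFolnerGroup G)
    (β : H →* G) (hβ : Function.Injective β) : IsFolnerGroup H := by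
  classical
  intro S ε hS hε
  lift S to Finset H using hS
  obtain ⟨F, hFf, hFn, hF⟩ := hG (β '' S) ε (S.finite_toSet.image _) hε
  lift F to Finset G using hFf
  rw [← Finset.coe_image, ← Finset.coe_mul, Set.ncard_coe_finset, Set.ncard_coe_finset] at hF
  let π : G → Quotient (QuotientGroup.rightRel β.range) := Quotient.mk _
  have hπ : ∀ h x, π (β h * x) = π x := fun h x => Quotient.sound <| by
    change QuotientGroup.rightRel β.range _ _
    rw [QuotientGroup.rightRel_apply]
    exact ⟨h⁻¹, by simp⟩
  have hex : ∃ q ∈ F.image π, ((S.image β * F.filter (π · = q)).card : ℝ) ≤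
      (1 + ε) * (F.filter (π · = q)).card := by
    by_contra! hcon
    have h1 : ∑ q ∈ F.image π, ((F.filter (π · = q)).card : ℝ) = F.card := by
      rw [Finset.card_eq_sum_card_image π F]
      push_cast
      rfl
    have h2 : ∑ q ∈ F.image π, ((S.image β * F.filter (π · = q)).card : ℝ) ≤
        ((S.image β * F).card : ℝ) := by
      rw [← Nat.cast_sum, Nat.cast_le, ← Finset.card_biUnion]
      · refine Finset.card_le_card (Finset.biUnion_subset.2 fun q _ => ?_)
        exact Finset.mul_subset_mul_left (Finset.filter_subset _ _)
      · intro q _ q' _ hqq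
        rw [Function.onFun, Finset.disjoint_left]
        intro z hz hz'
        obtain ⟨a, ha, b, hb, rfl⟩ := Finset.mem_mul.1 hz
        obtain ⟨a', ha', b', hb', hab⟩ := Finset.mem_mul.1 hz'
        obtain ⟨s, _, rfl⟩ := Finset.mem_image.1 ha
        obtain ⟨s', _, rfl⟩ := Finset.mem_image.1 ha'
        apply hqq
        rw [← (Finset.mem_filter.1 hb).2, ← (Finset.mem_filter.1 hb').2, ← hπ s b, ← hab, hπ]
    have h3 := Finset.sum_lt_sum_of_nonempty
      (Finset.image_nonempty.2 (by simpa using hFn)) hcon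
    rw [← Finset.mul_sum, h1] at h3
    linarith
  obtain ⟨q, hq, hle⟩ := hex
  obtain ⟨y, hy, rfl⟩ := Finset.mem_image.1 hq
  set E := F.filter (π · = π y) with hE
  have hinj : Function.Injective (fun h : H => β h * y) :=
    fun a b hab => hβ (mul_right_cancel hab)
  let D : Finset H := E.preimage (fun h => β h * y) hinj.injOn
  have hDE : D.image (fun h => β h * y) = E := by
    ext z
    simp only [D, Finset.mem_image, Finset.mem_preimage]
    constructor
    · rintro ⟨h, hh, rfl⟩; exact hh
    · intro hz
      have hzy : π y = π z := (Finset.mem_filter.1 hz).2.symm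
      have : QuotientGroup.rightRel β.range y z := Quotient.exact hzy
      rw [QuotientGroup.rightRel_apply] at this
      obtain ⟨h, hh⟩ := this
      have : β h * y = z := by rw [hh]; simp
      exact ⟨h, by rwa [this], this⟩
  have hcard : E.card = D.card := by rw [← hDE, Finset.card_image_of_injective _ hinj]
  refine ⟨D, D.finite_toSet, ⟨1, ?_⟩, ?_⟩
  · simp [D, hE, hy]
  · rw [← Finset.coe_mul, Set.ncard_coe_finset, Set.ncard_coe_finset, ← hcard]
    refine le_trans ?_ hle
    rw [Nat.cast_le, ← Finset.card_image_of_injective _ hinj]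
    apply Finset.card_le_card
    intro z hz
    obtain ⟨w, hw, rfl⟩ := Finset.mem_image.1 hz
    obtain ⟨a, ha, b, hb, rfl⟩ := Finset.mem_mul.1 hw
    rw [map_mul, mul_assoc]
    exact Finset.mul_mem_mul (Finset.mem_image_of_mem _ ha)
      (hDE ▸ Finset.mem_image_of_mem (fun h => β h * y) hb)

/-- The ratio of `S * F` to `F` is multiplicative in products, so a product of Følner sets works
once `(1 + δ) ^ |ι| ≤ 1 + ε`. -/
theorem IsFolnerGroup.pi {ι : Type*} [Finite ι] {G : ι → Type*} [∀ i, Group (G i)]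
    (hG : ∀ i, IsFolnerGroup (G i)) : IsFolnerGroup (∀ i, G i) := by
  classical
  cases nonempty_fintype ι
  intro S ε hS hε
  obtain ⟨δ, hδ, hδε⟩ : ∃ δ : ℝ, 0 < δ ∧ (1 + δ) ^ Fintype.card ι ≤ 1 + ε := by
    have hlog : 0 < Real.log (1 + ε) := Real.log_pos (by linarith)
    refine ⟨Real.log (1 + ε) / (Fintype.card ι + 1), by positivity, ?_⟩
    set d := Real.log (1 + ε) / (Fintype.card ι + 1) with hd
    have hd0 : 0 < d := by positivity
    have hmul : d * (Fintype.card ι + 1) = Real.log (1 + ε) := by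
      rw [hd]; field_simp
    calc (1 + d) ^ Fintype.card ι ≤ Real.exp d ^ Fintype.card ι := by
          gcongr; linarith [Real.add_one_le_exp d]
      _ = Real.exp (Fintype.card ι * d) := by rw [Real.exp_nat_mul]
      _ ≤ Real.exp (Real.log (1 + ε)) := Real.exp_le_exp.2 (by nlinarith)
      _ = 1 + ε := Real.exp_log (by linarith)
  choose F hFf hFn hF using fun i => hG i ((fun s => s i) '' S) δ (hS.image _) hδ
  refine ⟨Set.univ.pi F, Set.Finite.pi' hFf |>.subset (by intro x hx; simpa using hx), ?_, ?_⟩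
  · exact Set.univ_pi_nonempty_iff.2 hFn
  · have hsub : S * Set.univ.pi F ⊆ Set.univ.pi fun i => (fun s => s i) '' S * F i := by
      rintro _ ⟨s, hs, f, hf, rfl⟩ i _
      exact Set.mul_mem_mul ⟨s, hs, rfl⟩ (hf i trivial)
    have hfin : (Set.univ.pi fun i => (fun s : ∀ i, G i => s i) '' S * F i).Finite :=
      Set.Finite.pi' (fun i => (hS.image _).mul (hFf i)) |>.subset
        (by intro x hx; simpa using hx)
    have hncard : ∀ E : ∀ i, Set (G i), ((Set.univ.pi E).ncard : ℝ) = ∏ i, ((E i).ncard : ℝ) := by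
      intro E
      rw [← Nat.cast_prod, ← Nat.card_coe_set_eq, Nat.card_congr (Equiv.Set.univPi E),
        Nat.card_pi]
      simp
    calc ((S * Set.univ.pi F).ncard : ℝ)
        ≤ ((Set.univ.pi fun i => (fun s : ∀ i, G i => s i) '' S * F i).ncard : ℝ) := by
          exact_mod_cast Set.ncard_le_ncard hsub hfin
      _ = ∏ i, (((fun s : ∀ i, G i => s i) '' S * F i).ncard : ℝ) := hncard _
      _ ≤ ∏ i, ((1 + δ) * ((F i).ncard : ℝ)) :=
          Finset.prod_le_prod (fun _ _ => Nat.cast_nonneg _) fun i _ => hF i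
      _ = (1 + δ) ^ Fintype.card ι * (Set.univ.pi F).ncard := by
          rw [Finset.prod_mul_distrib, hncard]; simp
      _ ≤ _ := by gcongr

/-- With coset representatives `q.out`, left multiplication by `s` permutes the cosets and acts on
the `H`-coordinate through the cocycle `c s q`. For `s ∈ S` there are finitely many cocycle values;
a Følner set for them, multiplied by all representatives, is one for `S`. -/
theorem IsFolnerGroup.of_finiteIndex {G : Type*} [Group G] (H : Subgroup G) [Finite (G ⧸ H)]
    (hH : IsFolnerGroup H) : IsFolnerGroup G := by
  classical
  intro S ε hS hε
  let c : G → G ⧸ H → H := fun s q => ⟨(s • q).out⁻¹ * (s * q.out), by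
    rw [← QuotientGroup.eq, QuotientGroup.out_eq', ← smul_eq_mul, ← MulAction.Quotient.smul_mk,
      QuotientGroup.out_eq']⟩
  have hc : ∀ s q, s * q.out = (s • q).out * c s q := by
    intro s q; simp [c]
  obtain ⟨F, hFf, hFn, hF⟩ := hH (Set.image2 c S Set.univ) ε
    (hS.image2 _ Set.finite_univ) hε
  let j : (G ⧸ H) × H → G := fun p => p.1.out * p.2
  have hj : Function.Injective j := by
    rintro ⟨q, h⟩ ⟨q', h'⟩ he
    have he' : q.out * (h : G) = q'.out * h' := he
    have hq : q = q' := by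
      have := congrArg (QuotientGroup.mk (s := H)) he'
      rw [QuotientGroup.mk_mul_of_mem _ h.2, QuotientGroup.mk_mul_of_mem _ h'.2] at this
      simpa using this
    subst hq
    simpa using he'
  have hjcard : ∀ E : Set H, ((j '' (Set.univ ×ˢ E)).ncard : ℝ) = Nat.card (G ⧸ H) * E.ncard := by
    intro E
    rw [Set.ncard_image_of_injective _ hj, Set.ncard_prod, Set.ncard_univ, Nat.cast_mul]
  refine ⟨j '' (Set.univ ×ˢ F), (Set.finite_univ.prod hFf).image _, ?_, ?_⟩
  · exact (Set.univ_nonempty.prod hFn).image _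
  · have hsub : S * j '' (Set.univ ×ˢ F) ⊆ j '' (Set.univ ×ˢ (Set.image2 c S Set.univ * F)) := by
      rintro _ ⟨s, hs, _, ⟨⟨q, f⟩, ⟨-, hf⟩, rfl⟩, rfl⟩
      refine ⟨(s • q, c s q * f), ⟨trivial, Set.mul_mem_mul ⟨s, hs, q, trivial, rfl⟩ hf⟩, ?_⟩
      simp only [j, Subgroup.coe_mul]
      rw [← mul_assoc, ← hc, mul_assoc]
    have hfin : (j '' (Set.univ ×ˢ (Set.image2 c S Set.univ * F))).Finite :=
      (Set.finite_univ.prod ((hS.image2 _ Set.finite_univ).mul hFf)).image _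
    calc ((S * j '' (Set.univ ×ˢ F)).ncard : ℝ)
        ≤ ((j '' (Set.univ ×ˢ (Set.image2 c S Set.univ * F))).ncard : ℝ) := by
          exact_mod_cast Set.ncard_le_ncard hsub hfin
      _ ≤ Nat.card (G ⧸ H) * ((1 + ε) * F.ncard) := by rw [hjcard]; gcongr
      _ = _ := by rw [hjcard]; ring

/-- Følner sets are almost invariant under translation by the elements of a finite set. -/
theorem IsFolnerGroup.exists_almost_invariant {G : Type*} [Group G] (hG : IsFolnerGroup G)
    (S : Set G) (hS : S.Finite) (ε : ℝ) (hε : 0 < ε) :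
    ∃ F : Set G, F.Finite ∧ F.Nonempty ∧
      ∀ s ∈ S, ((F ∩ {f | s * f ∉ F}).ncard : ℝ) ≤ ε * F.ncard := by
  classical
  -- Adjoining `1` puts `F` inside the product set, so points leaving `F` inject into a difference
  -- of size at most `ε * F.ncard`.
  obtain ⟨F, hFf, hFn, hF⟩ := hG (insert 1 S) ε (hS.insert 1) hε
  refine ⟨F, hFf, hFn, fun s hs => ?_⟩
  have hsub : (s * ·) '' (F ∩ {f | s * f ∉ F}) ⊆ (insert 1 S * F) \ F := by
    rintro _ ⟨f, ⟨hf, hsf⟩, rfl⟩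
    exact ⟨Set.mul_mem_mul (Set.mem_insert_of_mem _ hs) hf, hsf⟩
  have hfin : (insert 1 S * F).Finite := (hS.insert 1).mul hFf
  have hle := Set.ncard_le_ncard hsub (hfin.subset Set.sdiff_subset)
  rw [Set.ncard_image_of_injective _ (mul_right_injective s)] at hle
  have hFsub : F ⊆ insert 1 S * F := fun f hf =>
    ⟨1, Set.mem_insert _ _, f, hf, one_mul f⟩
  have hd := Set.ncard_sdiff_add_ncard_of_subset hFsub hfin
  have hd' : (((insert 1 S * F) \ F).ncard : ℝ) + F.ncard = (insert 1 S * F).ncard := by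
    exact_mod_cast hd
  have : ((F ∩ {f | s * f ∉ F}).ncard : ℝ) ≤ ((insert 1 S * F) \ F).ncard := by
    exact_mod_cast hle
  linarith

end Folner

/-! ### Green's relations and one-sided inverses -/

section Green

variable {M : Type*} [Monoid M]

theorem greenL_iff {x y : M} : GreenL x y ↔ (∃ a, a * y = x) ∧ ∃ b, b * x = y := by
  constructor
  · intro h
    exact ⟨(Set.ext_iff.1 h x).1 ⟨1, one_mul x⟩, (Set.ext_iff.1 h y).2 ⟨1, one_mul y⟩⟩
  · rintro ⟨⟨a, ha⟩, b, hb⟩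
    ext z
    constructor
    · rintro ⟨c, rfl⟩
      exact ⟨c * a, by simp only [mul_assoc, ha]⟩
    · rintro ⟨c, rfl⟩
      exact ⟨c * b, by simp only [mul_assoc, hb]⟩

theorem greenR_iff {x y : M} : GreenR x y ↔ (∃ a, y * a = x) ∧ ∃ b, x * b = y := by
  constructor
  · intro h
    exact ⟨(Set.ext_iff.1 h x).1 ⟨1, mul_one x⟩, (Set.ext_iff.1 h y).2 ⟨1, mul_one y⟩⟩
  · rintro ⟨⟨a, ha⟩, b, hb⟩
    ext z
    constructor
    · rintro ⟨c, rfl⟩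
      exact ⟨a * c, by simp only [← mul_assoc, ha]⟩
    · rintro ⟨c, rfl⟩
      exact ⟨b * c, by simp only [← mul_assoc, hb]⟩

theorem GreenL.symm {x y : M} (h : GreenL x y) : GreenL y x := Eq.symm h

theorem GreenL.trans {x y z : M} (h : GreenL x y) (h' : GreenL y z) : GreenL x z := Eq.trans h h'

theorem GreenR.symm {x y : M} (h : GreenR x y) : GreenR y x := Eq.symm h

theorem GreenR.trans {x y z : M} (h : GreenR x y) (h' : GreenR y z) : GreenR x z := Eq.trans h h'

theorem GreenL.mul_right {x y : M} (h : GreenL x y) (m : M) : GreenL (x * m) (y * m) := by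
  rw [greenL_iff] at h ⊢
  obtain ⟨⟨a, ha⟩, b, hb⟩ := h
  exact ⟨⟨a, by rw [← mul_assoc, ha]⟩, b, by rw [← mul_assoc, hb]⟩

theorem greenR_mul_unit (x : M) (u : Mˣ) : GreenR x (x * u) :=
  greenR_iff.2 ⟨⟨(u⁻¹ : Mˣ), by simp [mul_assoc]⟩, u, rfl⟩

theorem lClass_eq_iff {x y : M} : lClass x = lClass y ↔ GreenL x y := by
  constructor
  · intro h
    have : y ∈ lClass y := rfl
    rwa [← h] at this
  · intro h
    ext z
    exact ⟨fun hz => h.symm.trans hz, fun hz => h.trans hz⟩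

/-- If the `D`-class of the identity has only finitely many `L`-classes then one-sided inverses
are two-sided. -/
theorem isDedekindFiniteMonoid_of_finite_lClassesInDClass_one
    (hfin : (lClassesInDClass (1 : M)).Finite) : IsDedekindFiniteMonoid M := by
  constructor
  intro p q hpq
  have hpow : ∀ n : ℕ, p ^ n * q ^ n = 1 := by
    intro n
    induction n with
    | zero => simp
    | succ n ih =>
      rw [pow_succ, pow_succ', mul_assoc, ← mul_assoc p q, hpq, one_mul, ih]
  -- Each `p ^ n` is right invertible, hence `R`-related to `1`. By pigeonhole two powers are
  -- `L`-related, and cancelling with a power of `q` gives `p` a left inverse.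
  have hmem : ∀ n : ℕ, lClass (p ^ n) ∈ lClassesInDClass (1 : M) := fun n =>
    ⟨p ^ n, ⟨1, rfl, greenR_iff.2 ⟨⟨q ^ n, hpow n⟩, p ^ n, one_mul _⟩⟩, rfl⟩
  obtain ⟨i, j, hij, hL⟩ : ∃ i j : ℕ, i < j ∧ lClass (p ^ i) = lClass (p ^ j) := by
    have : Finite (lClassesInDClass (1 : M)) := hfin
    obtain ⟨i, j, hne, h⟩ := Finite.exists_ne_map_eq_of_infinite
      (fun n : ℕ => (⟨lClass (p ^ n), hmem n⟩ : lClassesInDClass (1 : M)))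
    have h' : lClass (p ^ i) = lClass (p ^ j) := congrArg Subtype.val h
    rcases lt_or_gt_of_ne hne with hlt | hlt
    · exact ⟨i, j, hlt, h'⟩
    · exact ⟨j, i, hlt, h'.symm⟩
  obtain ⟨⟨a, ha⟩, -⟩ := greenL_iff.1 (lClass_eq_iff.1 hL)
  obtain ⟨k, rfl⟩ := Nat.exists_eq_add_of_lt hij
  have hleft : a * p ^ k * p = 1 := by
    have h := congrArg (· * q ^ i) ha
    simp only [hpow] at h
    rw [show i + k + 1 = k + 1 + i by ring, pow_add, mul_assoc, mul_assoc, hpow, mul_one,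
      pow_succ, ← mul_assoc] at h
    exact h
  rw [left_inv_eq_right_inv hleft hpq] at hleft
  exact hleft

/-! ### Translations by units and the Schützenberger groups -/

/-- The action of the group of units by right translation on a union of `R`-classes. -/
def unitTranslation (T : Set M) (hT : ∀ t ∈ T, ∀ s, GreenR t s → s ∈ T) :
    Mˣ →* (Equiv.Perm T)ᵐᵒᵖ where
  -- In the opposite group a product `u * f` means translating by `u` before applying `f`, which is
  -- what makes left translation on a Følner set compatible with the action of non-units.
  toFun u := MulOpposite.op
    { toFun := fun t => ⟨t * u, hT _ t.2 _ (greenR_mul_unit _ _)⟩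
      invFun := fun t => ⟨t * (u⁻¹ : Mˣ), hT _ t.2 _ (greenR_mul_unit _ _)⟩
      left_inv := fun t => by simp [mul_assoc]
      right_inv := fun t => by simp [mul_assoc] }
  map_one' := by
    apply MulOpposite.unop_injective
    ext t
    simp
  map_mul' u v := by
    apply MulOpposite.unop_injective
    ext t
    simp [mul_assoc]

variable {T : Set M} {hT : ∀ t ∈ T, ∀ s, GreenR t s → s ∈ T}

theorem coe_unop_eq_mul {σ : (Equiv.Perm T)ᵐᵒᵖ} (hσ : σ ∈ (unitTranslation T hT).range) :
    ∃ u : Mˣ, ∀ t : T, ((σ.unop t : T) : M) = t * u := by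
  obtain ⟨u, rfl⟩ := hσ
  exact ⟨u, fun t => rfl⟩

variable (T hT) in
/-- The translations by units which preserve all `L`-classes. -/
def lPreserving : Subgroup (unitTranslation T hT).range where
  carrier := {σ | ∀ t : T, GreenL ((σ.1.unop t : T) : M) t}
  one_mem' := fun t => rfl
  mul_mem' := by
    intro σ τ hσ hτ t
    exact (hτ (σ.1.unop t)).trans (hσ t)
  inv_mem' := by
    intro σ hσ t
    have h := hσ (σ.1.unop.symm t)
    rw [Equiv.apply_symm_apply] at h
    exact h.symm

/-- Right multiplication respects `L`, so a translation permutes the finitely many `L`-classes met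
by `T`. Left cosets are told apart by the effect of `σ⁻¹`, since `σ⁻¹ * τ` fixes every `L`-class as
soon as `σ⁻¹` and `τ⁻¹` move them alike. -/
theorem finite_quotient_lPreserving (hfin : (lClass '' T).Finite) :
    Finite ((unitTranslation T hT).range ⧸ lPreserving T hT) := by
  have : Finite (lClass '' T) := hfin
  choose y hyT hy using fun c : lClass '' T => c.2
  let f : (unitTranslation T hT).range → (lClass '' T → lClass '' T) := fun σ c =>
    ⟨lClass ((σ⁻¹.1.unop ⟨y c, hyT c⟩ : T) : M), _, Subtype.coe_prop _, rfl⟩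
  refine Finite.of_injective (fun q : _ ⧸ lPreserving T hT => f q.out) fun q q' hqq => ?_
  replace hqq : f q.out = f q'.out := hqq
  rw [← QuotientGroup.out_eq' q, ← QuotientGroup.out_eq' q', QuotientGroup.eq]
  generalize q.out = σ at hqq ⊢
  generalize q'.out = τ at hqq ⊢
  intro t
  have hc := congrArg Subtype.val (congrFun hqq ⟨lClass t, t, t.2, rfl⟩)
  have hL := lClass_eq_iff.1 hc
  have hyt := lClass_eq_iff.1 (hy ⟨lClass t, t, t.2, rfl⟩)
  obtain ⟨u, hu⟩ := coe_unop_eq_mul (σ⁻¹).2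
  obtain ⟨v, hv⟩ := coe_unop_eq_mul (τ⁻¹).2
  obtain ⟨w, hw⟩ := coe_unop_eq_mul τ.2
  rw [hu, hv] at hL
  have h1 : GreenL ((t : M) * u) (t * v) := (hyt.symm.mul_right u).trans (hL.trans (hyt.mul_right v))
  have h2 := h1.mul_right w
  have h3 : (t : M) * v * w = t := by
    rw [← hv, ← hw]
    exact congrArg Subtype.val (Equiv.apply_symm_apply τ.1.unop t)
  rw [h3, ← hu, ← hw] at h2
  exact h2

theorem hClass_subset (hT : ∀ t ∈ T, ∀ s, GreenR t s → s ∈ T) {t : M} (ht : t ∈ T) :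
    hClass t ⊆ T := fun s hs => hT t ht s hs.2

theorem lPreserving_apply_mem {σ : (unitTranslation T hT).range} (hσ : σ ∈ lPreserving T hT)
    {y : M} {h : T} (hh : (h : M) ∈ hClass y) : ((σ.1.unop h : T) : M) ∈ hClass y := by
  refine ⟨GreenL.trans hh.1 (hσ h).symm, GreenR.trans hh.2 ?_⟩
  obtain ⟨u, hu⟩ := coe_unop_eq_mul σ.2
  rw [hu]
  exact greenR_mul_unit _ _

/-- Restriction of an `L`-class preserving translation to an `H`-class. -/
def lPreservingToSchutzenberger (y : T) : lPreserving T hT →* schutzenbergerGroup (y : M) where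
  toFun σ := ⟨MulOpposite.op
    { toFun := fun h => ⟨σ.1.1.unop ⟨h, hClass_subset hT y.2 h.2⟩, lPreserving_apply_mem σ.2 h.2⟩
      invFun := fun h =>
        ⟨σ⁻¹.1.1.unop ⟨h, hClass_subset hT y.2 h.2⟩, lPreserving_apply_mem σ⁻¹.2 h.2⟩
      left_inv := fun h => Subtype.ext <| congrArg (fun t : T => (t : M)) <|
        Equiv.symm_apply_apply σ.1.1.unop ⟨h, hClass_subset hT y.2 h.2⟩
      right_inv := fun h => Subtype.ext <| congrArg (fun t : T => (t : M)) <|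
        Equiv.apply_symm_apply σ.1.1.unop ⟨h, hClass_subset hT y.2 h.2⟩ }, by
    obtain ⟨u, hu⟩ := coe_unop_eq_mul σ.1.2
    exact ⟨u, fun h => hu _⟩⟩
  map_one' := rfl
  map_mul' _ _ := rfl

/-- If `T` is a union of `R`-classes meeting finitely many `L`-classes and all its Schützenberger
groups are amenable, then the group of translations of `T` by units satisfies the Følner
condition. -/
theorem isFolnerGroup_unitTranslation_range
    (hschutz : ∀ t ∈ T, IsAmenableGroup (schutzenbergerGroup t))
    (hfin : (lClass '' T).Finite) : IsFolnerGroup (unitTranslation T hT).range := by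
  have := finite_quotient_lPreserving (hT := hT) hfin
  have : Finite (lClass '' T) := hfin
  choose y hyT hy using fun c : lClass '' T => c.2
  refine IsFolnerGroup.of_finiteIndex (lPreserving T hT) ?_
  refine IsFolnerGroup.of_injective
    (IsFolnerGroup.pi fun c : lClass '' T => (hschutz (y c) (hyT c)).isFolnerGroup)
    (MonoidHom.pi fun c => lPreservingToSchutzenberger (⟨y c, hyT c⟩ : T)) ?_
  intro σ τ hστ
  apply Subtype.ext
  apply Subtype.ext
  apply MulOpposite.unop_injective
  ext t
  obtain ⟨u, hu⟩ := coe_unop_eq_mul σ.1.2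
  obtain ⟨v, hv⟩ := coe_unop_eq_mul τ.1.2
  have h := congrFun hστ ⟨lClass t, t, t.2, rfl⟩
  have hyt := lClass_eq_iff.1 (hy ⟨lClass t, t, t.2, rfl⟩)
  set z := y ⟨lClass t, t, t.2, rfl⟩
  have hzz : z ∈ hClass z := ⟨rfl, rfl⟩
  have h' : z * u = z * v := by
    have h1 := congrArg (fun ρ : schutzenbergerGroup z => ((ρ.1.unop ⟨z, hzz⟩ : hClass z) : M)) h
    exact (hu _).symm.trans (h1.trans (hv _))
  -- Every `t` is a left multiple of the representative `z` of its `L`-class, so a right translation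
  -- is determined by its values on the representatives.
  obtain ⟨-, b, hb⟩ := greenL_iff.1 hyt
  rw [hu, hv, ← hb, mul_assoc, mul_assoc, h']

end Green

/-! ### Counting lemmas for proportions -/

section Proportion

variable {X : Type*} [Fintype X]

theorem proportion_eq_ncard_div (p : X → Prop) :
    proportion p = ({x | p x}.ncard : ℝ) / Fintype.card X := rfl

theorem proportion_mono {p q : X → Prop} (h : ∀ x, p x → q x) : proportion p ≤ proportion q := by
  rw [proportion_eq_ncard_div, proportion_eq_ncard_div]
  refine div_le_div_of_nonneg_right ?_ (Nat.cast_nonneg _)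
  exact_mod_cast Set.ncard_le_ncard (s := {x | p x}) (t := {x | q x}) h (Set.toFinite _)

theorem proportion_or_le (p q : X → Prop) :
    proportion (fun x => p x ∨ q x) ≤ proportion p + proportion q := by
  rw [proportion_eq_ncard_div, proportion_eq_ncard_div, proportion_eq_ncard_div, ← add_div]
  gcongr
  exact_mod_cast Set.ncard_union_le {x | p x} {x | q x}

theorem proportion_false : proportion (fun _ : X => False) = 0 := by
  simp [proportion_eq_ncard_div]

theorem proportion_not [Nonempty X] (p : X → Prop) :
    proportion (fun x => ¬ p x) = 1 - proportion p := by
  have h := Set.ncard_add_ncard_compl {x | p x}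
  have h' : ({x | p x}.ncard : ℝ) + ({x | ¬ p x}.ncard : ℝ) = Fintype.card X := by
    rw [← Nat.card_eq_fintype_card]
    exact_mod_cast h
  have hX : (0 : ℝ) < Fintype.card X := by exact_mod_cast Fintype.card_pos
  rw [proportion_eq_ncard_div, proportion_eq_ncard_div, eq_sub_iff_add_eq, ← add_div, add_comm, h',
    div_self hX.ne']

theorem proportion_comp_equiv {X' : Type*} [Fintype X'] (e : X ≃ X') (p : X' → Prop) :
    proportion (fun x => p (e x)) = proportion p := by
  unfold proportion
  rw [Fintype.card_congr e, Nat.card_congr (e.subtypeEquiv fun _ => Iff.rfl)]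

/-- A property of the points of `Fin n × A × B ⊕ Y` is rare if it forces a rare property of one of
the two components and `Y` is comparatively small. -/
theorem proportion_sum_le {n : ℕ} {A B Y : Type*} [Fintype A] [Fintype B] [Fintype Y]
    [Nonempty A] [Nonempty B] (hn : 0 < n) (p : (Fin n × A × B) ⊕ Y → Prop)
    (pA : A → Prop) (pB : B → Prop)
    (hp : ∀ i a b, p (Sum.inl (i, a, b)) → pA a ∨ pB b) {ε₁ ε₂ ε₃ : ℝ}
    (hA : proportion pA ≤ ε₁) (hB : proportion pB ≤ ε₂)
    (hY : (Fintype.card Y : ℝ) ≤ ε₃ * (n * (Fintype.card A * Fintype.card B))) :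
    proportion p ≤ ε₁ + ε₂ + ε₃ := by
  have hA0 : (0 : ℝ) < Fintype.card A := by exact_mod_cast Fintype.card_pos
  have hB0 : (0 : ℝ) < Fintype.card B := by exact_mod_cast Fintype.card_pos
  have hn0 : (0 : ℝ) < n := by exact_mod_cast hn
  have hN : (0 : ℝ) < n * (Fintype.card A * Fintype.card B) := by positivity
  rw [proportion_eq_ncard_div, div_le_iff₀ (by assumption)] at hA hB
  have hsub : {x | p x} ⊆ Sum.inl '' (Set.univ ×ˢ ({a | pA a} ×ˢ Set.univ)) ∪
      Sum.inl '' (Set.univ ×ˢ (Set.univ ×ˢ {b | pB b})) ∪ Set.range Sum.inr := by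
    rintro (⟨i, a, b⟩ | y) hx
    · left
      rcases hp i a b hx with h | h
      · exact Or.inl ⟨(i, a, b), ⟨trivial, h, trivial⟩, rfl⟩
      · exact Or.inr ⟨(i, a, b), ⟨trivial, trivial, h⟩, rfl⟩
    · exact Or.inr ⟨y, rfl⟩
  have h1 := (Set.ncard_le_ncard hsub (Set.toFinite _)).trans ((Set.ncard_union_le _ _).trans
    (Nat.add_le_add_right (Set.ncard_union_le _ _) _))
  rw [Set.ncard_image_of_injective _ Sum.inl_injective,
    Set.ncard_image_of_injective _ Sum.inl_injective, ← Set.image_univ,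
    Set.ncard_image_of_injective _ Sum.inr_injective, Set.ncard_prod, Set.ncard_prod,
    Set.ncard_prod, Set.ncard_prod] at h1
  simp only [Set.ncard_univ, Nat.card_eq_fintype_card, Fintype.card_fin] at h1
  have h2 : ({x | p x}.ncard : ℝ) ≤ n * ({a | pA a}.ncard * Fintype.card B) +
      n * (Fintype.card A * {b | pB b}.ncard) + Fintype.card Y := by exact_mod_cast h1
  -- Nonnegativity lets the points of `Y` be added to the denominator in the last estimate.
  have hε : 0 ≤ ε₁ + ε₂ + ε₃ := by
    have e1 : 0 ≤ ε₁ := nonneg_of_mul_nonneg_left ((Nat.cast_nonneg _).trans hA) hA0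
    have e2 : 0 ≤ ε₂ := nonneg_of_mul_nonneg_left ((Nat.cast_nonneg _).trans hB) hB0
    have e3 : 0 ≤ ε₃ := nonneg_of_mul_nonneg_left ((Nat.cast_nonneg _).trans hY) hN
    positivity
  have hcard : (Fintype.card ((Fin n × A × B) ⊕ Y) : ℝ) =
      n * (Fintype.card A * Fintype.card B) + Fintype.card Y := by simp
  have hYn : (0 : ℝ) ≤ Fintype.card Y := Nat.cast_nonneg _
  rw [proportion_eq_ncard_div, hcard, div_le_iff₀ (by positivity)]
  calc ({x | p x}.ncard : ℝ)
      ≤ n * (ε₁ * Fintype.card A * Fintype.card B) + n * (Fintype.card A * (ε₂ * Fintype.card B)) +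
        ε₃ * (n * (Fintype.card A * Fintype.card B)) := by
          refine h2.trans ?_
          gcongr
    _ = (ε₁ + ε₂ + ε₃) * (n * (Fintype.card A * Fintype.card B)) := by ring
    _ ≤ _ := mul_le_mul_of_nonneg_left (by linarith) hε

theorem IsFolnerGroup.exists_proportion_le {G : Type*} [Group G] (hG : IsFolnerGroup G)
    (S : Set G) (hS : S.Finite) (ε : ℝ) (hε : 0 < ε) :
    ∃ (F : Set G) (_ : Fintype F), Nonempty F ∧
      ∀ s ∈ S, proportion (fun f : F => s * (f : G) ∉ F) ≤ ε := by
  obtain ⟨F, hFf, hFn, hF⟩ := hG.exists_almost_invariant S hS ε hε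
  let _ : Fintype F := hFf.fintype
  have := hFn.to_subtype
  refine ⟨F, inferInstance, hFn.to_subtype, fun s hs => ?_⟩
  have hF0 : (0 : ℝ) < Fintype.card F := by exact_mod_cast Fintype.card_pos
  rw [proportion_eq_ncard_div, div_le_iff₀ hF0, ← Nat.card_eq_fintype_card, Nat.card_coe_set_eq]
  refine (congrArg Nat.cast ?_).trans_le (hF s hs)
  rw [← Set.ncard_image_of_injective _ Subtype.val_injective]
  congr 1
  ext x
  simp [and_comm]

end Proportion

/-- Soficity can be tested on finite sets in an arbitrary universe. -/
theorem isSofic_of_exists_isApproxAction.{u, v} {M : Type u} [Monoid M]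
    (h : ∀ (K : Finset M) (ε : ℝ), 0 < ε →
      ∃ (X : Type v) (_ : Fintype X) (_ : Nonempty X) (act : M → X → X),
        IsApproxAction K ε act) : IsSofic M := by
  intro K ε hε
  obtain ⟨X, _, _, act, hact⟩ := h K ε hε
  let e := Fintype.equivFin X
  refine ⟨Fin (Fintype.card X), inferInstance, ⟨e (Classical.arbitrary X)⟩,
    fun m x => e (act m (e.symm x)), ?_, ?_, ?_⟩
  · intro x
    simp [hact.one_act]
  · intro g hg h hh
    refine (hact.mul_act g hg h hh).trans_eq ?_
    rw [← proportion_comp_equiv e.symm]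
    congr 1
    ext x
    simp
  · intro g hg h hh hgh
    refine le_trans (le_of_eq ?_) (hact.act_ne g hg h hh hgh)
    rw [← proportion_comp_equiv e.symm]
    congr 1
    ext x
    simp

/-! ### The approximate action of the whole monoid -/

section Extension

variable {M : Type*} [Monoid M] {T : Set M} {hT : ∀ t ∈ T, ∀ s, GreenR t s → s ∈ T}

open Classical in
/-- Left translation on a subset of a group, leaving fixed the points that would leave the
subset. -/
noncomputable def partialTranslation {G : Type*} [Group G] (F : Set G) (s : G) (f : F) : F :=
  if h : s * f ∈ F then ⟨s * f, h⟩ else f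

theorem partialTranslation_of_mem {G : Type*} [Group G] {F : Set G} {s : G} {f : F}
    (h : s * f ∈ F) : partialTranslation F s f = ⟨s * f, h⟩ := dif_pos h

open Classical in
/-- The map `M × X → X` on `X = Fin n × A × F ⊕ Y` in which units act diagonally on the first
summand, and non-units send `(i, a, f)` to their image under the translation `f`. -/
noncomputable def extendedAction {n : ℕ} {A : Type*} (actA : Mˣ → A → A)
    (F : Set (unitTranslation T hT).range) (Y : Set M) (m : M) :
    (Fin n × A × F) ⊕ Y → (Fin n × A × F) ⊕ Y
  | Sum.inl (i, a, f) =>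
    if hm : IsUnit m then
      Sum.inl (i, actA hm.unit a,
        partialTranslation F ((unitTranslation T hT).rangeRestrict hm.unit) f)
    -- For the non-units that matter, `T` and `Y` are chosen so that this condition holds for every
    -- `f`; the remaining branch is a default value.
    else if h : ∃ ht : m ∈ T, ((f.1.1.unop ⟨m, ht⟩ : T) : M) ∈ Y then Sum.inr ⟨_, h.2⟩
    else Sum.inl (i, a, f)
  -- `Y` need not be stable under left multiplication; its points are too few for the default to
  -- matter.
  | Sum.inr y => if h : m * y ∈ Y then Sum.inr ⟨m * y, h⟩ else Sum.inr y

variable {n : ℕ} {A : Type*} {actA : Mˣ → A → A} {F : Set (unitTranslation T hT).range}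
  {Y : Set M}

theorem extendedAction_unit_inl (u : Mˣ) (i : Fin n) (a : A) (f : F) :
    extendedAction actA F Y (u : M) (Sum.inl (i, a, f)) = Sum.inl (i, actA u a,
      partialTranslation F ((unitTranslation T hT).rangeRestrict u) f) := by
  rw [extendedAction, dif_pos u.isUnit, IsUnit.unit_of_val_units]

theorem extendedAction_nonunit_inl {m : M} (hm : ¬ IsUnit m) (ht : m ∈ T) {f : F}
    (hY : ((f.1.1.unop ⟨m, ht⟩ : T) : M) ∈ Y) (i : Fin n) (a : A) :
    extendedAction actA F Y m (Sum.inl (i, a, f)) = Sum.inr ⟨_, hY⟩ := by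
  rw [extendedAction, dif_neg hm, dif_pos ⟨ht, hY⟩]

theorem extendedAction_inr {m : M} {y : Y} (h : m * y ∈ Y) :
    extendedAction (n := n) actA F Y m (Sum.inr y) = Sum.inr ⟨m * y, h⟩ := by
  rw [extendedAction, dif_pos h]

theorem extendedAction_one (h1 : ∀ a, actA 1 a = a) (x : (Fin n × A × F) ⊕ Y) :
    extendedAction actA F Y 1 x = x := by
  rcases x with ⟨i, a, f⟩ | y
  · have h := extendedAction_unit_inl (actA := actA) (Y := Y) 1 i a f
    rw [Units.val_one] at h
    rw [h, h1, map_one, partialTranslation_of_mem (by simp)]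
    simp
  · rw [extendedAction_inr (by simp)]
    simp

end Extension

section Extension

variable {M : Type*} [Monoid M] {T : Set M} {hT : ∀ t ∈ T, ∀ s, GreenR t s → s ∈ T}

/-- The extended action is multiplicative at `(i, a, f)` unless the action of the units on `A` fails
to be multiplicative at `a`, or one of the translations involved moves `f` out of `F`. -/
theorem extendedAction_mul {n : ℕ} {A : Type*} {actA : Mˣ → A → A}
    {F : Set (unitTranslation T hT).range} {Y : Set M} [IsDedekindFiniteMonoid M] {K : Set M}
    (hKT : ∀ m ∈ K, ¬ IsUnit m → m ∈ T)
    (hKY : ∀ (t : T) (f : F), (t : M) ∈ K → ((f.1.1.unop t : T) : M) ∈ Y)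
    {g h : M} (hg : g ∈ K) (hh : h ∈ K) (hgh : g * h ∈ K) {i : Fin n} {a : A} {f : F}
    (hA : ∀ u v : Mˣ, (u : M) = g → (v : M) = h → actA u (actA v a) = actA (u * v) a)
    (hF : ∀ v : Mˣ, (v : M) = h → (unitTranslation T hT).rangeRestrict v * f ∈ F)
    (hF' : ∀ v : Mˣ, (v : M) = g * h → (unitTranslation T hT).rangeRestrict v * f ∈ F) :
    extendedAction actA F Y g (extendedAction actA F Y h (Sum.inl (i, a, f))) =
      extendedAction actA F Y (g * h) (Sum.inl (i, a, f)) := by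
  by_cases hhu : IsUnit h
  · obtain ⟨v, rfl⟩ := hhu
    rw [extendedAction_unit_inl, partialTranslation_of_mem (hF v rfl)]
    by_cases hgu : IsUnit g
    · obtain ⟨u, rfl⟩ := hgu
      have hm := hF' (u * v) (Units.val_mul u v)
      have hm' := hm
      rw [map_mul, mul_assoc] at hm'
      rw [← Units.val_mul, extendedAction_unit_inl, extendedAction_unit_inl, hA u v rfl rfl,
        partialTranslation_of_mem hm, partialTranslation_of_mem hm']
      simp only [map_mul, mul_assoc]
    · have hghu : ¬ IsUnit (g * v) := fun hu => hgu (isUnit_of_mul_isUnit_left hu)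
      rw [extendedAction_nonunit_inl hgu (hKT g hg hgu) (hKY _ _ hg),
        extendedAction_nonunit_inl hghu (hKT _ hgh hghu) (hKY _ _ hgh)]
      -- Both sides apply `f` to `g * v`, by the order of composition in the opposite group.
      rfl
  · have hghu : ¬ IsUnit (g * h) := fun hu => hhu (isUnit_of_mul_isUnit_right hu)
    rw [extendedAction_nonunit_inl hhu (hKT h hh hhu) (hKY _ _ hh),
      extendedAction_nonunit_inl hghu (hKT _ hgh hghu) (hKY _ _ hgh)]
    -- Being right multiplication by a unit, `f` commutes with left multiplication by `g`.
    obtain ⟨u, hu⟩ := coe_unop_eq_mul f.1.2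
    have heq : g * ((f.1.1.unop ⟨h, hKT h hh hhu⟩ : T) : M) =
        (f.1.1.unop ⟨g * h, hKT _ hgh hghu⟩ : T) := by
      rw [hu, hu, mul_assoc]
    rw [extendedAction_inr (by rw [heq]; exact hKY _ _ hgh)]
    exact congrArg Sum.inr (Subtype.ext heq)

/-- Distinct elements act differently at `(i, a, f)` unless they are units which act equally
on `a`. -/
theorem eq_of_extendedAction_eq {n : ℕ} {A : Type*} {actA : Mˣ → A → A}
    {F : Set (unitTranslation T hT).range} {Y : Set M} {K : Set M}
    (hKT : ∀ m ∈ K, ¬ IsUnit m → m ∈ T)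
    (hKY : ∀ (t : T) (f : F), (t : M) ∈ K → ((f.1.1.unop t : T) : M) ∈ Y)
    {g h : M} (hg : g ∈ K) (hh : h ∈ K) {i : Fin n} {a : A} {f : F}
    (heq : extendedAction actA F Y g (Sum.inl (i, a, f)) =
      extendedAction actA F Y h (Sum.inl (i, a, f)))
    (hA : ∀ u v : Mˣ, (u : M) = g → (v : M) = h → actA u a ≠ actA v a) : g = h := by
  -- Units stay in the first summand and non-units of `K` land in `Y`, so the mixed cases are
  -- impossible; two non-units are compared through the injectivity of `f` on `T`.
  by_cases hgu : IsUnit g <;> by_cases hhu : IsUnit h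
  · obtain ⟨u, rfl⟩ := hgu
    obtain ⟨v, rfl⟩ := hhu
    rw [extendedAction_unit_inl, extendedAction_unit_inl] at heq
    exact absurd (Prod.mk.inj (Prod.mk.inj (Sum.inl_injective heq)).2).1 (hA u v rfl rfl)
  · obtain ⟨u, rfl⟩ := hgu
    rw [extendedAction_unit_inl,
      extendedAction_nonunit_inl hhu (hKT h hh hhu) (hKY _ _ hh)] at heq
    cases heq
  · obtain ⟨v, rfl⟩ := hhu
    rw [extendedAction_unit_inl,
      extendedAction_nonunit_inl hgu (hKT g hg hgu) (hKY _ _ hg)] at heq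
    cases heq
  · rw [extendedAction_nonunit_inl hgu (hKT g hg hgu) (hKY _ _ hg),
      extendedAction_nonunit_inl hhu (hKT h hh hhu) (hKY _ _ hh)] at heq
    have h1 := Subtype.ext_iff.1 (Sum.inr_injective heq)
    exact congrArg Subtype.val (f.1.1.unop.injective (Subtype.ext h1))

/-- If the group of units is sofic, one-sided inverses are two-sided, and the group of unit
translations on the `R`-classes of any finite set of non-units satisfies the Følner condition,
then the monoid is sofic. -/
theorem isSofic_of_isFolnerGroup_unitTranslation [IsDedekindFiniteMonoid M] (hunits : IsSofic Mˣ)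
    (hfolner : ∀ E : Set M, E.Finite → (∀ m ∈ E, ¬ IsUnit m) →
      ∃ (T : Set M) (hT : ∀ t ∈ T, ∀ s, GreenR t s → s ∈ T), E ⊆ T ∧
        IsFolnerGroup (unitTranslation T hT).range) : IsSofic M := by
  classical
  refine isSofic_of_exists_isApproxAction fun K ε hε => ?_
  -- Multiplicativity on `K` also involves the action of the products `g * h`.
  let K₂ : Set M := ↑(K ∪ K * K)
  have hK₂ : K₂.Finite := Finset.finite_toSet _
  have hKK₂ : ∀ g ∈ K, g ∈ K₂ := fun g hg => Finset.mem_coe.2 (Finset.mem_union_left _ hg)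
  have hmulK₂ : ∀ g ∈ K, ∀ h ∈ K, g * h ∈ K₂ := fun g hg h hh =>
    Finset.mem_coe.2 (Finset.mem_union_right _ (Finset.mul_mem_mul hg hh))
  obtain ⟨T, hT, hET, hQ⟩ := hfolner {m ∈ K₂ | ¬ IsUnit m} (hK₂.subset (Set.sep_subset _ _))
    fun m hm => hm.2
  have hKT : ∀ m ∈ K₂, ¬ IsUnit m → m ∈ T := fun m hm hmu => hET ⟨hm, hmu⟩
  -- The error `ε` is split in four: one part for `A`, two for `F` (translations by `h` and by `g *
  -- h`), and one for `Y`.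
  obtain ⟨A, _, _, actA, hactA⟩ := hunits (K.preimage Units.val Units.val_injective.injOn) (ε / 4)
    (by positivity)
  have hS : (Units.val ⁻¹' K₂ : Set Mˣ).Finite := hK₂.preimage Units.val_injective.injOn
  obtain ⟨F, _, _, hF⟩ := hQ.exists_proportion_le
    ((unitTranslation T hT).rangeRestrict '' (Units.val ⁻¹' K₂)) (hS.image _) (ε / 4)
    (by positivity)
  let Y : Set M := Set.image2 (fun (t : T) (f : (unitTranslation T hT).range) =>
    ((f.1.unop t : T) : M)) (Subtype.val ⁻¹' K₂) F
  have hYfin : Y.Finite :=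
    Set.Finite.image2 _ (hK₂.preimage Subtype.val_injective.injOn) F.toFinite
  let _ : Fintype Y := hYfin.fintype
  have hKY : ∀ (t : T) (f : F), (t : M) ∈ K₂ → ((f.1.1.unop t : T) : M) ∈ Y :=
    fun t f ht => ⟨t, ht, f, f.2, rfl⟩
  have hA0 : (0 : ℝ) < Fintype.card A := by exact_mod_cast Fintype.card_pos
  have hF0 : (0 : ℝ) < Fintype.card F := by exact_mod_cast Fintype.card_pos
  -- `Y` depends on `F` but not on `n`, so enough copies of `A × F` make it negligible.
  obtain ⟨n, hn⟩ := exists_nat_gt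
    ((Fintype.card Y : ℝ) / (ε / 4 * (Fintype.card A * Fintype.card F)))
  have hn0 : 0 < n := by
    have : (0 : ℝ) < n := lt_of_le_of_lt (by positivity) hn
    exact_mod_cast this
  have hY : (Fintype.card Y : ℝ) ≤ ε / 4 * (n * (Fintype.card A * Fintype.card F)) := by
    rw [div_lt_iff₀ (by positivity)] at hn
    exact hn.le.trans_eq (by ring)
  have : Nonempty (Fin n) := ⟨⟨0, hn0⟩⟩
  -- Quantifying over units `v` equal to `m` makes the condition vacuous for non-units.
  have hFv : ∀ m ∈ K₂, proportion (fun f : F => ¬ ∀ v : Mˣ, (v : M) = m →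
      (unitTranslation T hT).rangeRestrict v * (f : (unitTranslation T hT).range) ∈ F) ≤
        ε / 4 := by
    intro m hm
    by_cases hmu : IsUnit m
    · obtain ⟨v, rfl⟩ := hmu
      refine le_trans (proportion_mono (q := fun f : F => (unitTranslation T hT).rangeRestrict v *
        (f : (unitTranslation T hT).range) ∉ F) fun f hf hvF => hf fun w hw => ?_)
        (hF _ ⟨v, hm, rfl⟩)
      rwa [Units.ext hw]
    · refine le_trans (proportion_mono (q := fun _ => False) fun f hf => hf ?_)
        (proportion_false.trans_le (by positivity))
      rintro v rfl
      exact absurd v.isUnit hmu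
  refine ⟨(Fin n × A × F) ⊕ Y, inferInstance, inferInstance, extendedAction actA F Y,
    extendedAction_one hactA.one_act, fun g hg h hh => ?_, fun g hg h hh hne => ?_⟩
  · have hA : proportion (fun a : A => ¬ ∀ u v : Mˣ, (u : M) = g → (v : M) = h →
        actA u (actA v a) = actA (u * v) a) ≤ ε / 4 := by
      by_cases huv : ∃ u v : Mˣ, (u : M) = g ∧ (v : M) = h
      · obtain ⟨u, v, rfl, rfl⟩ := huv
        refine le_trans (proportion_mono (q := fun a : A =>
          ¬ actA u (actA v a) = actA (u * v) a) fun a ha h' => ha fun u' v' hu' hv' => ?_) ?_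
        · rwa [Units.ext hu', Units.ext hv']
        · rw [proportion_not]
          linarith [hactA.mul_act u (by simpa using hg) v (by simpa using hh)]
      · refine le_trans (proportion_mono (q := fun _ => False) fun f hf => hf ?_)
          (proportion_false.trans_le (by positivity))
        intro u v hu hv
        exact absurd ⟨u, v, hu, hv⟩ huv
    have hbad := proportion_sum_le (Y := Y) hn0
      (fun x : (Fin n × A × F) ⊕ Y => ¬ extendedAction actA F Y g (extendedAction actA F Y h x) =
        extendedAction actA F Y (g * h) x) _ _ (fun i a f hx => by
          by_contra! hcon
          exact hx (extendedAction_mul hKT hKY (hKK₂ g hg) (hKK₂ h hh) (hmulK₂ g hg h hh)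
            hcon.1 hcon.2.1 hcon.2.2)) hA
      ((proportion_or_le _ _).trans (add_le_add (hFv h (hKK₂ h hh)) (hFv _ (hmulK₂ g hg h hh)))) hY
    rw [proportion_not] at hbad
    linarith
  · have hA : proportion (fun a : A => ¬ ∀ u v : Mˣ, (u : M) = g → (v : M) = h →
        actA u a ≠ actA v a) ≤ ε / 4 := by
      by_cases huv : ∃ u v : Mˣ, (u : M) = g ∧ (v : M) = h
      · obtain ⟨u, v, rfl, rfl⟩ := huv
        refine le_trans (proportion_mono (q := fun a : A => actA u a = actA v a)
          fun a ha => ?_) (hactA.act_ne u (by simpa using hg) v (by simpa using hh)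
            fun huv => hne (congrArg _ huv))
        by_contra h'
        exact ha fun u' v' hu' hv' => by rwa [Units.ext hu', Units.ext hv']
      · refine le_trans (proportion_mono (q := fun _ => False) fun f hf => hf ?_)
          (proportion_false.trans_le (by positivity))
        intro u v hu hv
        exact absurd ⟨u, v, hu, hv⟩ huv
    have hbad := proportion_sum_le (Y := Y) hn0
      (fun x : (Fin n × A × F) ⊕ Y => extendedAction actA F Y g x = extendedAction actA F Y h x)
      _ (fun _ => False) (fun i a f hx => by
          by_contra! hcon
          exact hne (eq_of_extendedAction_eq hKT hKY (hKK₂ g hg) (hKK₂ h hh) hx hcon.1)) hA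
      proportion_false.le hY
    linarith

end Extension

/-! ### The main theorem -/

theorem corollary4p2 {M : Type*} [Monoid M]
    (hunits : IsSofic Mˣ)
    (hschutz : ∀ x : M, ¬ IsUnit x → IsAmenableGroup (schutzenbergerGroup x))
    (hfin : ∀ x : M, (lClassesInDClass x).Finite) :
    IsSofic M := by
  have := isDedekindFiniteMonoid_of_finite_lClassesInDClass_one (hfin 1)
  refine isSofic_of_isFolnerGroup_unitTranslation hunits fun E hE hEu => ?_
  -- `T` is the union of the `R`-classes of `E`. It consists of non-units, since a unit in `m * M`
  -- would make `m` a unit, and it lies in finitely many `D`-classes, hence meets finitely many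
  -- `L`-classes.
  refine ⟨{t | ∃ m ∈ E, GreenR m t}, fun t ⟨m, hm, hmt⟩ s hts => ⟨m, hm, hmt.trans hts⟩,
    fun m hm => ⟨m, hm, rfl⟩, isFolnerGroup_unitTranslation_range ?_ ?_⟩
  · rintro t ⟨m, hm, hmt⟩
    refine hschutz t fun ht => hEu m hm ?_
    obtain ⟨-, b, rfl⟩ := greenR_iff.1 hmt
    exact isUnit_of_mul_isUnit_left ht
  · refine (hE.biUnion fun m _ => hfin m).subset ?_
    rintro _ ⟨t, ⟨m, hm, hmt⟩, rfl⟩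
    exact Set.mem_biUnion hm ⟨t, ⟨m, rfl, hmt⟩, rfl⟩
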